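/- Let $D\subset\mathbb R^n$ be closed and bounded, let $m\ge 2$, let $V_1,\dots,V_m\subset D$ be pairwise disjoint nonempty compact sets, and let $f:D\to\mathbb R^n$ be continuous on $\bigcup_i V_i$ and strictly coupled-expanding in $V_1,\dots,V_m$, i.e. $f(V_i)\supset\bigcup_{j=1}^m V_j$ for every $i$, and $d(V_i,V_j)>0$ for $i\ne j$. Assume that there are constants $\lambda_1,\dots,\lambda_m>1$ with $$d(f(x),f(y))=\lambda_i\,d(x,y)\qquad (x,y\in V_i,\ 1\le i\le m).$$ For every finite word $a_0\dots a_k$ over $\{1,\dots,m\}$ put $\Delta_{a_0\dots a_k}=\bigcap_{j=0}^k f^{-j}(V_{a_j})$. Then these sets, with the full shift $\Sigma_m^+=\{1,\dots,m\}^{\mathbb N}$, form a symbolic geometric construction: they are closed, $\Delta_{a_0\dots a_{k+1}}\subset\Delta_{a_0\dots a_k}$, the sets belonging to different words of the same length are disjoint, and $\max_{a_0\dots a_k}\operatorname{diam}\Delta_{a_0\dots a_k}\to 0$ as $k\to\infty$. Its limit set $$V=\bigcap_{k\ge 0}\ \bigcup_{a_0\dots a_k}\Delta_{a_0\dots a_k}$$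 satisfies $f(V)=V$. The equation $$\lambda_1^{-p}+\dots+\lambda_m^{-p}=1$$ has exactly one real solution $p_0$, it is positive, and $$\dim_H V=p_0,\qquad \dim_H LY_f(V)=2p_0,$$ where $LY_f(V)$ is the set of Li–Yorke pairs in $V$, that is, of all $(x,y)\in V\times V$ with $\liminf_{k\to\infty}d(f^kx,f^ky)=0$ and $\limsup_{k\to\infty}d(f^kx,f^ky)>0$. -/

import Mathlib

open Set Filter Topology

/-- `(x, y)` is a Li-Yorke pair for `T`. The distances are taken in `ℝ≥0∞`, so that the lower and
upper limits are the genuine ones even along unbounded orbits. -/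
def IsLiYorkePair {X : Type*} [MetricSpace X] (T : X → X) (x y : X) : Prop :=
  liminf (fun n : ℕ => edist (T^[n] x) (T^[n] y)) atTop = 0 ∧
    0 < limsup (fun n : ℕ => edist (T^[n] x) (T^[n] y)) atTop

/-- The set of Li-Yorke pairs of `T` in `Λ`. -/
def liYorkePairs {X : Type*} [MetricSpace X] (T : X → X) (Λ : Set X) : Set (X × X) :=
  {z | z.1 ∈ Λ ∧ z.2 ∈ Λ ∧ IsLiYorkePair T z.1 z.2}

/-- `f`, considered on `D`, is coupled-expanding in the sets `V i ⊆ D` (the transition matrix has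
all entries equal to `1`). -/
structure IsCoupledExpanding {X : Type*} [MetricSpace X] {m : ℕ} (f : X → X) (D : Set X)
    (V : Fin m → Set X) : Prop where
  two_le : 2 ≤ m
  subset : ∀ i, V i ⊆ D
  nonempty : ∀ i, (V i).Nonempty
  disjoint_interior : ∀ i j, i ≠ j → Disjoint (interior (V i)) (interior (V j))
  covers : ∀ i, (⋃ j, V j) ⊆ f '' V i

/-- `f` is strictly coupled-expanding: in addition, distinct `V i`, `V j` are at positive
distance. -/
structure IsStrictlyCoupledExpanding {X : Type*} [MetricSpace X] {m : ℕ} (f : X → X) (D : Set X)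
    (V : Fin m → Set X) : Prop extends IsCoupledExpanding f D V where
  separated : ∀ i j, i ≠ j → Metric.AreSeparated (V i) (V j)

/-- The one-sided shift on sequences of symbols. -/
def shiftMap {m : ℕ} (s : ℕ → Fin m) : ℕ → Fin m := fun k => s (k + 1)

/-- The word `a 0, …, a n` is admissible with respect to `Q`: it is the beginning of some sequence
in `Q`. -/
def IsAdmissible {m : ℕ} (Q : Set (ℕ → Fin m)) {n : ℕ} (a : Fin (n + 1) → Fin m) : Prop :=
  ∃ s ∈ Q, ∀ j : Fin (n + 1), s j = a j

/-- `(Q, Δ)` is a symbolic geometric construction; `Δ n a` is the basic set of the word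
`a 0, …, a n`, and `Fin.init a` is the word `a` without its last letter. -/
structure IsSymbolicGeometricConstruction {X : Type*} [MetricSpace X] {m : ℕ}
    (Q : Set (ℕ → Fin m)) (Δ : (n : ℕ) → (Fin (n + 1) → Fin m) → Set X) : Prop where
  invariant : shiftMap '' Q = Q
  closed : ∀ (n : ℕ) (a : Fin (n + 1) → Fin m), IsAdmissible Q a → IsClosed (Δ n a)
  nested : ∀ (n : ℕ) (a : Fin (n + 2) → Fin m), IsAdmissible Q a →
    Δ (n + 1) a ⊆ Δ n (Fin.init a)
  disjoint : ∀ (n : ℕ) (a b : Fin (n + 1) → Fin m), IsAdmissible Q a → IsAdmissible Q b →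
    a ≠ b → Disjoint (Δ n a) (Δ n b)
  diam_tendsto : Tendsto
    (fun n : ℕ => ⨆ (a : Fin (n + 1) → Fin m) (_ : IsAdmissible Q a), Metric.ediam (Δ n a))
    atTop (𝓝 0)

/-- The limit set of a symbolic geometric construction. -/
def limitSet {X : Type*} {m : ℕ} (Q : Set (ℕ → Fin m))
    (Δ : (n : ℕ) → (Fin (n + 1) → Fin m) → Set X) : Set X :=
  ⋂ n : ℕ, ⋃ (a : Fin (n + 1) → Fin m) (_ : IsAdmissible Q a), Δ n a

/-- The basic set `⋂_{j = 0}^{n} f^{-j}(V_{a_j})`. When `V i ⊆ D` for all `i`, a point `x` of this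
set has `x, f x, …, f^n x` in `D`, so the set depends only on the restriction of `f` to `D`. -/
def basicSet {X : Type*} {m : ℕ} (f : X → X) (V : Fin m → Set X) (n : ℕ)
    (a : Fin (n + 1) → Fin m) : Set X :=
  ⋂ j : Fin (n + 1), f^[(j : ℕ)] ⁻¹' V (a j)

/-! The covering relation makes the nested compact sets of every symbol sequence nonempty, and
expansion makes them shrink to a point. So the limit set is the image of the full shift under a
coding map `π`. If two codes first disagree at place `k`, then `f^[k]` multiplies the distance of
the points by exactly the product of the `lam i` along the common word and puts them into different
`V i`. Hence that distance lies between `δ` and `C` times the product of the ratios `1 / lam i`: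
this is `IsSelfSimilarCoding`, and it makes balls comparable with cylinders.

Let `p` solve the Moran equation. The Bernoulli measure with weights `r i ^ p` gives a cylinder the
mass (scale)`^ p`, so small balls of radius `ε` centred in the limit set have mass comparable to `ε
^ p`; mass estimates in both directions give the dimension. Two independent copies give balls of the
max metric mass comparable to `ε ^ (2 * p)`, which bounds the dimension of all pairs from above.
Almost every pair of codes agrees on arbitrarily long blocks infinitely often (second Borel–Cantelli
lemma) and disagrees infinitely often. Such pairs are Li–Yorke, so the Li–Yorke set carries the
whole product mass and attains the bound. -/

open MeasureTheory

/-! ### Hausdorff dimension from the mass of balls -/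

/-- If a finite measure gives every ball of radius `r` centred in `A` mass at least `b`,
then `A` is covered by at most `ν univ / b` balls of radius `2 * r`. -/
theorem exists_finset_cover_of_le_measure_closedBall {X : Type*} [MetricSpace X]
    [MeasurableSpace X] [BorelSpace X] (ν : Measure X) [IsFiniteMeasure ν] {A : Set X} {b r : ℝ}
    (hb : 0 < b) (hr : 0 < r) (h : ∀ x ∈ A, ENNReal.ofReal b ≤ ν (Metric.closedBall x r)) :
    ∃ F : Finset X, A ⊆ ⋃ x ∈ F, Metric.closedBall x (2 * r) ∧
      F.card * b ≤ (ν univ).toReal := by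
  have key : ∀ F : Finset X, (F : Set X) ⊆ A →
      Metric.IsSeparated (ENNReal.ofReal (2 * r)) (F : Set X) →
      F.card * b ≤ (ν univ).toReal := by
    intro F hFA hF
    have hdisj : (F : Set X).PairwiseDisjoint (fun x => Metric.closedBall x r) := by
      intro x hx y hy hxy
      have : ENNReal.ofReal (2 * r) < edist x y := hF hx hy hxy
      rw [edist_dist, ENNReal.ofReal_lt_ofReal_iff_of_nonneg (by positivity)] at this
      exact Metric.closedBall_disjoint_closedBall (by linarith)
    have h1 : ∑ x ∈ F, ENNReal.ofReal b ≤ ν univ := by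
      calc ∑ x ∈ F, ENNReal.ofReal b ≤ ∑ x ∈ F, ν (Metric.closedBall x r) :=
            Finset.sum_le_sum fun x hx => h x (hFA hx)
        _ = ν (⋃ x ∈ F, Metric.closedBall x r) :=
            (measure_biUnion_finset hdisj fun x _ => Metric.isClosed_closedBall.measurableSet).symm
        _ ≤ ν univ := measure_mono (subset_univ _)
    have h2 := ENNReal.toReal_mono (measure_ne_top ν univ) h1
    simpa [ENNReal.toReal_ofReal hb.le] using h2
  obtain ⟨k, hk⟩ := exists_nat_gt ((ν univ).toReal / b)
  -- A separated set with more than `k > ν univ / b` points would contain one with exactly `k`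
  -- points, against `key`. A maximal separated set is therefore finite, and by maximality it is a
  -- cover.
  have hpack : Metric.packingNumber (2 * r).toNNReal A ≠ ⊤ := by
    refine ne_top_of_le_ne_top (ENat.natCast_ne_top k) ?_
    refine iSup_le fun C => iSup_le fun hCA => iSup_le fun hC => ?_
    by_contra! hlt
    obtain ⟨t, htC, ht⟩ := Set.exists_subset_encard_eq hlt.le
    have htf : t.Finite := Set.finite_of_encard_eq_coe ht
    have := key htf.toFinset (by simpa using htC.trans hCA)
      (by rw [htf.coe_toFinset]; exact hC.subset htC)
    rw [← le_div_iff₀ hb, ← Set.ncard_eq_toFinset_card t htf, Set.ncard, ht,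
      ENat.toNat_natCast] at this
    linarith
  have hfin : (Metric.maximalSeparatedSet (2 * r).toNNReal A).Finite := by
    rw [← Set.encard_ne_top_iff, Metric.encard_maximalSeparatedSet hpack]
    exact hpack
  refine ⟨hfin.toFinset, ?_, ?_⟩
  · have := Metric.isCover_iff_subset_iUnion_closedBall.1 (Metric.isCover_maximalSeparatedSet hpack)
    simpa [Real.coe_toNNReal _ (by positivity : 0 ≤ 2 * r)] using this
  · exact key _ (by simpa using Metric.maximalSeparatedSet_subset)
      (by rw [hfin.coe_toFinset]; exact Metric.isSeparated_maximalSeparatedSet)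

/-- Upper bound of the Hausdorff dimension by a lower bound of the mass of balls. -/
theorem dimH_le_of_le_measure_closedBall {X : Type*} [MetricSpace X]
    [MeasurableSpace X] [BorelSpace X] (ν : Measure X) [IsFiniteMeasure ν] {A : Set X}
    {s c r₀ : ℝ} (hs : 0 ≤ s) (hc : 0 < c) (hr₀ : 0 < r₀)
    (h : ∀ x ∈ A, ∀ r, 0 < r → r < r₀ → ENNReal.ofReal (c * r ^ s) ≤ ν (Metric.closedBall x r)) :
    dimH A ≤ ENNReal.ofReal s := by
  let ρ : ℕ → ℝ := fun k => r₀ / 2 * (1 / ((k : ℝ) + 1))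
  have hρ : ∀ k, 0 < ρ k := fun k => by positivity
  have hρlt : ∀ k, ρ k < r₀ := fun k => by
    have : 1 / ((k : ℝ) + 1) ≤ 1 := by
      rw [div_le_one (by positivity)]; linarith [(Nat.cast_nonneg k : (0 : ℝ) ≤ k)]
    calc ρ k ≤ r₀ / 2 * 1 := mul_le_mul_of_nonneg_left this (by positivity)
      _ < r₀ := by linarith
  have hρlim : Tendsto ρ atTop (𝓝 0) := by
    have := (tendsto_one_div_add_atTop_nhds_zero_nat (𝕜 := ℝ)).const_mul (r₀ / 2)
    rwa [mul_zero] at this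
  choose F hF hcard using fun k =>
    exists_finset_cover_of_le_measure_closedBall ν (A := A)
      (mul_pos hc (Real.rpow_pos_of_pos (hρ k) s)) (hρ k) (fun x hx => h x hx _ (hρ k) (hρlt k))
  have hdiam : ∀ k (x : X), Metric.ediam (Metric.closedBall x (2 * ρ k)) ≤
      ENNReal.ofReal (4 * ρ k) := fun k x => by
    refine Metric.ediam_le_of_forall_dist_le fun y hy z hz => ?_
    rw [Metric.mem_closedBall] at hy hz
    linarith [dist_triangle_right y z x]
  have hsum : ∀ k, ∑ x : F k, Metric.ediam (Metric.closedBall (x : X) (2 * ρ k)) ^ s ≤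
      ENNReal.ofReal ((ν univ).toReal / c * 4 ^ s) := fun k => by
    calc ∑ x : F k, Metric.ediam (Metric.closedBall (x : X) (2 * ρ k)) ^ s
        ≤ ∑ x : F k, ENNReal.ofReal ((4 * ρ k) ^ s) := by
          refine Finset.sum_le_sum fun x _ => ?_
          rw [← ENNReal.ofReal_rpow_of_nonneg (by have := hρ k; positivity) hs]
          exact ENNReal.rpow_le_rpow (hdiam k x) hs
      _ = ENNReal.ofReal ((F k).card * (4 * ρ k) ^ s) := by
          rw [ENNReal.ofReal_mul (by positivity)]
          simp
      _ ≤ _ := by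
          apply ENNReal.ofReal_le_ofReal
          rw [Real.mul_rpow (by norm_num) (hρ k).le]
          have h4 : (0 : ℝ) < 4 ^ s := by positivity
          have : (F k).card * ρ k ^ s ≤ (ν univ).toReal / c := by
            rw [le_div_iff₀ hc]
            linarith [hcard k]
          nlinarith
  have hH : μH[s] A ≤ ENNReal.ofReal ((ν univ).toReal / c * 4 ^ s) := by
    refine (Measure.hausdorffMeasure_le_liminf_sum (ι := fun k => F k) (l := atTop) s A
      (fun k => ENNReal.ofReal (4 * ρ k)) ?_
      (fun k x => Metric.closedBall (x : X) (2 * ρ k)) ?_ ?_).trans ?_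
    · simpa using ENNReal.tendsto_ofReal (hρlim.const_mul 4)
    · exact Eventually.of_forall fun k x => hdiam k x
    · exact Eventually.of_forall fun k x hx => by
        have := hF k hx
        simpa using this
    · exact (liminf_le_liminf (Eventually.of_forall hsum)).trans (by simp)
  have := dimH_le_of_hausdorffMeasure_ne_top (s := A) (d := s.toNNReal)
    (by rw [Real.coe_toNNReal _ hs]; exact ne_top_of_le_ne_top ENNReal.ofReal_ne_top hH)
  exact this

/-- The mass distribution principle for balls centred in the set. -/
theorem le_dimH_of_measure_closedBall_le {X : Type*} [MetricSpace X]
    [MeasurableSpace X] [BorelSpace X] (ν : Measure X) {A : Set X}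
    {s c : ℝ} (hs : 0 < s) (hc : 0 < c)
    (h : ∀ x ∈ A, ∀ r, 0 < r → ν (Metric.closedBall x r) ≤ ENNReal.ofReal (c * r ^ s))
    (hA : ν A ≠ 0) : ENNReal.ofReal s ≤ dimH A := by
  -- Radius `0` is needed for test sets of diameter `0`; it follows by letting the radius decrease
  -- to `r`.
  have h0 : ∀ x ∈ A, ∀ r, 0 ≤ r → ν (Metric.closedBall x r) ≤ ENNReal.ofReal (c * r ^ s) := by
    intro x hx r hr
    have hlim : Tendsto (fun ρ : ℝ => ENNReal.ofReal (c * ρ ^ s)) (𝓝[>] r)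
        (𝓝 (ENNReal.ofReal (c * r ^ s))) := by
      refine (ENNReal.continuous_ofReal.tendsto _).comp ?_
      exact (((Real.continuous_rpow_const hs.le).const_mul c).tendsto r).mono_left
        nhdsWithin_le_nhds
    refine ge_of_tendsto hlim ?_
    filter_upwards [self_mem_nhdsWithin] with ρ hρ
    exact (measure_mono (Metric.closedBall_subset_closedBall (le_of_lt hρ))).trans
      (h x hx ρ (hr.trans_lt hρ))
  have hc' : ENNReal.ofReal c ≠ 0 := by simpa using hc
  -- A test set meeting `A` at `x` has its trace on `A` in the ball about `x` of radius its
  -- diameter. Passing to the closure keeps the diameter and gives measurability.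
  have hle : (ENNReal.ofReal c)⁻¹ • ν.restrict A ≤ μH[s] := by
    refine Measure.le_hausdorffMeasure s _ 1 one_pos fun U hU => ?_
    have hUtop : Metric.ediam (closure U) ≠ ⊤ := by
      rw [Metric.ediam_closure]; exact ne_top_of_le_ne_top ENNReal.one_ne_top hU
    rw [Measure.smul_apply, smul_eq_mul, ENNReal.inv_mul_le_iff hc' ENNReal.ofReal_ne_top,
      ← Metric.ediam_closure U]
    refine (measure_mono subset_closure).trans ?_
    rw [Measure.restrict_apply isClosed_closure.measurableSet]
    rcases (closure U ∩ A).eq_empty_or_nonempty with he | ⟨x, hxU, hxA⟩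
    · simp [he]
    · have hsub : closure U ∩ A ⊆ Metric.closedBall x (Metric.ediam (closure U)).toReal := by
        intro y hy
        rw [Metric.mem_closedBall, dist_edist]
        exact ENNReal.toReal_mono hUtop (Metric.edist_le_ediam_of_mem hy.1 hxU)
      refine (measure_mono hsub).trans ((h0 x hxA _ ENNReal.toReal_nonneg).trans ?_)
      rw [ENNReal.ofReal_mul hc.le, ← ENNReal.ofReal_rpow_of_nonneg ENNReal.toReal_nonneg hs.le,
        ENNReal.ofReal_toReal hUtop]
  have hne : μH[s] A ≠ 0 := by
    refine (lt_of_lt_of_le ?_ (hle A)).ne'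
    rw [Measure.smul_apply, Measure.restrict_apply_self, smul_eq_mul]
    exact ENNReal.mul_pos (by simp) hA
  have := le_dimH_of_hausdorffMeasure_ne_zero (s := A) (d := s.toNNReal)
    (by rwa [Real.coe_toNNReal _ hs.le])
  exact this

/-! ### Independent trials -/

/-- The mass of a pair of cylinders for the independent product of two Bernoulli measures. -/
theorem infinitePi_prod_cylinder {ι : Type*} [MeasurableSpace ι] [MeasurableSingletonClass ι]
    (w : Measure ι) [IsProbabilityMeasure w] (s t : ℕ → ι) (k l : ℕ) :
    Measure.infinitePi (fun _ : ℕ => w.prod w)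
      {ω | (∀ j < k, (ω j).1 = s j) ∧ ∀ j < l, (ω j).2 = t j} =
      (∏ j ∈ Finset.range k, w {s j}) * ∏ j ∈ Finset.range l, w {t j} := by
  classical
  have hset : {ω : ℕ → ι × ι | (∀ j < k, (ω j).1 = s j) ∧ ∀ j < l, (ω j).2 = t j} =
      Set.pi (Finset.range (k + l) : Set ℕ) (fun j =>
        (if j < k then {s j} else univ) ×ˢ (if j < l then {t j} else univ)) := by
    ext ω
    simp only [mem_ofPred_eq, Set.mem_pi, Finset.coe_range, mem_Iio, mem_prod]
    constructor
    · rintro ⟨h1, h2⟩ j -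
      constructor
      · split_ifs with h
        · exact h1 j h
        · trivial
      · split_ifs with h
        · exact h2 j h
        · trivial
    · intro h
      constructor
      · intro j hj
        simpa [hj] using (h j (by omega)).1
      · intro j hj
        simpa [hj] using (h j (by omega)).2
  have hprod : ∀ (u : ℕ → ι) (a : ℕ), a ≤ k + l →
      ∏ j ∈ Finset.range (k + l), w (if j < a then {u j} else univ) =
        ∏ j ∈ Finset.range a, w {u j} := by
    intro u a ha
    rw [← Finset.prod_subset (Finset.range_mono ha)]
    · exact Finset.prod_congr rfl fun j hj => by rw [if_pos (Finset.mem_range.1 hj)]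
    · intro j _ hj
      rw [if_neg (by simpa using hj), measure_univ]
  have hmeas : ∀ (u : ℕ → ι) (a j : ℕ),
      MeasurableSet (if j < a then {u j} else univ : Set ι) := by
    intro u a j
    split_ifs
    · exact measurableSet_singleton _
    · exact MeasurableSet.univ
  rw [hset, Measure.infinitePi_pi _ (fun j _ => (hmeas s k j).prod (hmeas t l j))]
  simp_rw [Measure.prod_prod]
  rw [Finset.prod_mul_distrib, hprod s k (by omega), hprod t l (by omega)]

/-- Almost every sequence of independent trials contains, infinitely often, a run of `L`
consecutive values in a set of positive mass. -/
theorem ae_frequently_run_infinitePi {α : Type*} [MeasurableSpace α] (κ : Measure α)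
    [IsProbabilityMeasure κ] {A : Set α} (hA : MeasurableSet A) (hA0 : κ A ≠ 0) {L : ℕ}
    (hL : 0 < L) :
    ∀ᵐ ω ∂(Measure.infinitePi (fun _ : ℕ => κ)), ∃ᶠ k in atTop, ∀ j < L, ω (k + j) ∈ A := by
  classical
  -- Only runs starting at multiples of `L` are used: these blocks are disjoint, so the events are
  -- independent.
  let E : ℕ → Set (ℕ → α) := fun k => Set.pi (Finset.Ico (k * L) (k * L + L) : Set ℕ) fun _ => A
  have hE : ∀ k, MeasurableSet (E k) := fun k =>
    MeasurableSet.pi (Finset.countable_toSet _) fun _ _ => hA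
  have hEm : ∀ k, Measure.infinitePi (fun _ : ℕ => κ) (E k) = κ A ^ L := fun k => by
    rw [Measure.infinitePi_pi _ (fun _ _ => hA)]
    simp
  have hind : ProbabilityTheory.iIndepSet E (Measure.infinitePi (fun _ : ℕ => κ)) := by
    rw [ProbabilityTheory.iIndepSet_iff_meas_biInter hE]
    intro T
    have hT : (⋂ k ∈ T, E k) =
        Set.pi ((T.biUnion fun k => Finset.Ico (k * L) (k * L + L) : Finset ℕ) : Set ℕ)
          fun _ => A := by
      ext ω
      simp only [E, mem_iInter, Set.mem_pi, Finset.mem_coe, Finset.mem_biUnion]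
      exact ⟨fun h j ⟨k, hk, hj⟩ => h k hk j hj, fun h k hk j hj => h j ⟨k, hk, hj⟩⟩
    rw [hT, Measure.infinitePi_pi _ (fun _ _ => hA), Finset.prod_biUnion]
    · refine Finset.prod_congr rfl fun k _ => ?_
      rw [hEm]
      simp
    · intro k _ l _ hkl
      refine Finset.disjoint_left.2 fun j hj hj' => hkl ?_
      rw [Finset.mem_Ico] at hj hj'
      have h1 : j / L = k := Nat.div_eq_of_lt_le (by linarith) (by nlinarith)
      have h2 : j / L = l := Nat.div_eq_of_lt_le (by linarith) (by nlinarith)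
      rw [← h1, h2]
  have hsum : ∑' k, Measure.infinitePi (fun _ : ℕ => κ) (E k) = ⊤ := by
    simp_rw [hEm]
    exact ENNReal.tsum_const_eq_top_of_ne_zero (pow_ne_zero _ hA0)
  have hone := ProbabilityTheory.measure_limsup_eq_one hE hind hsum
  have hae : ∀ᵐ ω ∂(Measure.infinitePi (fun _ : ℕ => κ)), ω ∈ limsup E atTop := by
    rw [← prob_compl_eq_zero_iff (MeasurableSet.measurableSet_limsup hE)] at hone
    exact hone
  filter_upwards [hae] with ω hω
  rw [mem_limsup_iff_frequently_mem] at hω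
  have htend : Tendsto (fun k : ℕ => k * L) atTop atTop :=
    tendsto_id.atTop_mul_const' hL
  refine htend.frequently (hω.mono fun k hk j hj => hk (k * L + j) ?_)
  simp [hj]

/-! ### Codings with self-similar scales -/

/-- `∏_{j < k} r (s j)`, the size of the cylinder of the first `k` letters of `s`. -/
noncomputable def cylinderScale {m : ℕ} (r : Fin m → ℝ) (s : ℕ → Fin m) (k : ℕ) : ℝ :=
  ∏ j ∈ Finset.range k, r (s j)

/-- A coding map by sequences of symbols for which the distance of two points is comparable with the
product of the ratios along the common beginning of their codes. -/
structure IsSelfSimilarCoding {X : Type*} [MetricSpace X] {m : ℕ} (r : Fin m → ℝ)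
    (π : (ℕ → Fin m) → X) (δ C : ℝ) : Prop where
  ratio_pos : ∀ i, 0 < r i
  ratio_lt_one : ∀ i, r i < 1
  lower_pos : 0 < δ
  upper_pos : 0 < C
  dist_le : ∀ s t k, (∀ j < k, t j = s j) → dist (π t) (π s) ≤ C * cylinderScale r s k
  le_dist : ∀ s t k, (∀ j < k, t j = s j) → t k ≠ s k → δ * cylinderScale r s k ≤ dist (π t) (π s)

theorem cylinderScale_zero {m : ℕ} (r : Fin m → ℝ) (s : ℕ → Fin m) : cylinderScale r s 0 = 1 := by
  simp [cylinderScale]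

theorem cylinderScale_succ {m : ℕ} (r : Fin m → ℝ) (s : ℕ → Fin m) (k : ℕ) :
    cylinderScale r s (k + 1) = cylinderScale r s k * r (s k) :=
  Finset.prod_range_succ _ _

theorem cylinderScale_pos {m : ℕ} {r : Fin m → ℝ} (hr : ∀ i, 0 < r i) (s : ℕ → Fin m) (k : ℕ) :
    0 < cylinderScale r s k :=
  Finset.prod_pos fun _ _ => hr _

/-- Finitely many ratios below `1` have a common bound below `1`. -/
theorem exists_ratio_bound {m : ℕ} {r : Fin m → ℝ} (hr1 : ∀ i, r i < 1) :
    ∃ ρ, 0 < ρ ∧ ρ < 1 ∧ ∀ i, r i ≤ ρ := by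
  rcases isEmpty_or_nonempty (Fin m) with h | h
  · exact ⟨1 / 2, by norm_num, by norm_num, fun i => (h.false i).elim⟩
  · obtain ⟨i₀, hi₀⟩ := Finite.exists_max r
    exact ⟨max (r i₀) (1 / 2), by positivity, max_lt (hr1 _) (by norm_num),
      fun i => (hi₀ i).trans (le_max_left _ _)⟩

theorem exists_ratio_lower_bound {m : ℕ} {r : Fin m → ℝ} (hr : ∀ i, 0 < r i) :
    ∃ σ, 0 < σ ∧ ∀ i, σ ≤ r i := by
  rcases isEmpty_or_nonempty (Fin m) with h | h
  · exact ⟨1, one_pos, fun i => (h.false i).elim⟩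
  · obtain ⟨i₀, hi₀⟩ := Finite.exists_min r
    exact ⟨r i₀, hr _, hi₀⟩

theorem cylinderScale_le_pow {m : ℕ} {r : Fin m → ℝ} (hr : ∀ i, 0 < r i) {ρ : ℝ}
    (hρ : ∀ i, r i ≤ ρ) (s : ℕ → Fin m) (k : ℕ) : cylinderScale r s k ≤ ρ ^ k := by
  calc cylinderScale r s k ≤ ∏ _j ∈ Finset.range k, ρ :=
        Finset.prod_le_prod (fun _ _ => (hr _).le) fun _ _ => hρ _
    _ = ρ ^ k := by simp

/-- The first generation at which the scale drops to a prescribed size. -/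
theorem exists_first_scale_le {m : ℕ} {r : Fin m → ℝ} (hr : ∀ i, 0 < r i) (hr1 : ∀ i, r i < 1)
    (s : ℕ → Fin m) {c ε : ℝ} (hε : 0 < ε) :
    ∃ k, c * cylinderScale r s k ≤ ε ∧ ∀ j < k, ε < c * cylinderScale r s j := by
  classical
  have hex : ∃ k, c * cylinderScale r s k ≤ ε := by
    obtain ⟨ρ, hρ0, hρ1, hρ⟩ := exists_ratio_bound hr1
    have hlim : Tendsto (fun k => |c| * ρ ^ k) atTop (𝓝 0) := by
      simpa using (tendsto_pow_atTop_nhds_zero_of_lt_one hρ0.le hρ1).const_mul |c|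
    obtain ⟨k, hk⟩ := (hlim.eventually_lt_const hε).exists
    refine ⟨k, le_trans ?_ hk.le⟩
    exact mul_le_mul (le_abs_self c) (cylinderScale_le_pow hr hρ s k)
      (cylinderScale_pos hr s k).le (abs_nonneg c)
  exact ⟨Nat.find hex, Nat.find_spec hex, fun j hj => not_le.1 (Nat.find_min hex hj)⟩

namespace IsSelfSimilarCoding

variable {X : Type*} [MetricSpace X] {m : ℕ} {r : Fin m → ℝ} {π : (ℕ → Fin m) → X} {δ C : ℝ}

/-- A first disagreement before the scale has dropped to `ε / δ` would already force a distance
above `ε`. This bounds the mass of balls from above. -/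
theorem exists_cylinder_of_dist_le (h : IsSelfSimilarCoding r π δ C) (s : ℕ → Fin m) {ε : ℝ}
    (hε : 0 < ε) :
    ∃ k, cylinderScale r s k ≤ ε / δ ∧ ∀ t, dist (π t) (π s) ≤ ε → ∀ j < k, t j = s j := by
  obtain ⟨k, hk, hlt⟩ := exists_first_scale_le h.ratio_pos h.ratio_lt_one s (c := δ) hε
  refine ⟨k, by rw [le_div_iff₀ h.lower_pos]; linarith, fun t ht j => ?_⟩
  induction j using Nat.strong_induction_on with
  | _ j ih =>
    intro hj
    by_contra hne
    have := h.le_dist s t j (fun i hi => ih i hi (hi.trans hj)) hne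
    linarith [hlt j hj]

/-- Stopping when the scale first reaches `ε / C` overshoots by at most one ratio, whence the factor
`σ`; `ε < C` excludes stopping at the empty word. This bounds the mass of balls from below. -/
theorem exists_cylinder_dist_le (h : IsSelfSimilarCoding r π δ C) {σ : ℝ} (hσ : ∀ i, σ ≤ r i)
    (s : ℕ → Fin m) {ε : ℝ} (hε : 0 < ε) (hεC : ε < C) :
    ∃ k, ε / C * σ ≤ cylinderScale r s k ∧ ∀ t, (∀ j < k, t j = s j) → dist (π t) (π s) ≤ ε := by
  obtain ⟨k, hk, hlt⟩ := exists_first_scale_le h.ratio_pos h.ratio_lt_one s (c := C) hε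
  refine ⟨k, ?_, fun t ht => (h.dist_le s t k ht).trans hk⟩
  cases k with
  | zero =>
    rw [cylinderScale_zero] at hk
    linarith
  | succ k =>
    rw [cylinderScale_succ]
    have h1 : ε / C ≤ cylinderScale r s k := by
      rw [div_le_iff₀ h.upper_pos]
      linarith [hlt k (Nat.lt_succ_self k)]
    have h2 : 0 < ε / C := div_pos hε h.upper_pos
    exact (mul_le_mul_of_nonneg_left (hσ _) h2.le).trans
      (mul_le_mul_of_nonneg_right h1 (h.ratio_pos _).le)

protected theorem continuous (h : IsSelfSimilarCoding r π δ C) : Continuous π := by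
  obtain ⟨ρ, hρ0, hρ1, hρ⟩ := exists_ratio_bound h.ratio_lt_one
  have hlim : Tendsto (fun k => C * ρ ^ k) atTop (𝓝 0) := by
    simpa using (tendsto_pow_atTop_nhds_zero_of_lt_one hρ0.le hρ1).const_mul C
  rw [continuous_iff_continuousAt]
  intro s
  rw [ContinuousAt, Metric.tendsto_nhds]
  intro ε hε
  obtain ⟨k, hk⟩ := (hlim.eventually_lt_const hε).exists
  have hev : ∀ᶠ t in 𝓝 s, ∀ j ∈ Finset.range k, t j = s j := by
    rw [Filter.eventually_all_finset]
    intro j _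
    have := ((continuous_apply j).tendsto s : Tendsto (fun t : ℕ → Fin m => t j) (𝓝 s) _)
    rw [nhds_discrete (Fin m)] at this
    exact this.eventually (p := fun i => i = s j) rfl
  filter_upwards [hev] with t ht
  refine (h.dist_le s t k fun j hj => ht j (Finset.mem_range.2 hj)).trans_lt (lt_of_le_of_lt ?_ hk)
  exact mul_le_mul_of_nonneg_left (cylinderScale_le_pow h.ratio_pos hρ s k) h.upper_pos.le

end IsSelfSimilarCoding

/-! ### Bernoulli measures with Moran weights -/

/-- The probability measure on the symbols with weights `r i ^ p`. -/
noncomputable def symbolMeasure {m : ℕ} (r : Fin m → ℝ) (p : ℝ) : Measure (Fin m) :=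
  ∑ i, ENNReal.ofReal (r i ^ p) • Measure.dirac i

theorem symbolMeasure_singleton {m : ℕ} (r : Fin m → ℝ) (p : ℝ) (i : Fin m) :
    symbolMeasure r p {i} = ENNReal.ofReal (r i ^ p) := by
  classical
  simp [symbolMeasure, Measure.finsetSum_apply, Set.indicator_apply]

theorem isProbabilityMeasure_symbolMeasure {m : ℕ} {r : Fin m → ℝ} {p : ℝ} (hr : ∀ i, 0 < r i)
    (hp : ∑ i, r i ^ p = 1) : IsProbabilityMeasure (symbolMeasure r p) := by
  constructor
  simp only [symbolMeasure, Measure.finsetSum_apply, Measure.smul_apply, measure_univ, smul_eq_mul,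
    mul_one]
  rw [← ENNReal.ofReal_sum_of_nonneg fun i _ => (Real.rpow_pos_of_pos (hr i) p).le, hp,
    ENNReal.ofReal_one]

theorem prod_symbolMeasure {m : ℕ} {r : Fin m → ℝ} (hr : ∀ i, 0 < r i) (p : ℝ) (s : ℕ → Fin m)
    (k : ℕ) : ∏ j ∈ Finset.range k, symbolMeasure r p {s j} =
      ENNReal.ofReal (cylinderScale r s k ^ p) := by
  simp_rw [symbolMeasure_singleton]
  rw [← ENNReal.ofReal_prod_of_nonneg fun j _ => (Real.rpow_pos_of_pos (hr _) p).le, cylinderScale,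
    Real.finsetProd_rpow _ _ fun j _ => (hr _).le]

/-- The independent product of two copies of the Bernoulli measure with weights `r i ^ p`. -/
noncomputable def pairMeasure {m : ℕ} (r : Fin m → ℝ) (p : ℝ) : Measure (ℕ → Fin m × Fin m) :=
  Measure.infinitePi fun _ => (symbolMeasure r p).prod (symbolMeasure r p)

theorem pairMeasure_cylinder {m : ℕ} {r : Fin m → ℝ} {p : ℝ} (hr : ∀ i, 0 < r i)
    (hp : ∑ i, r i ^ p = 1) (s t : ℕ → Fin m) (k l : ℕ) :
    pairMeasure r p {ω | (∀ j < k, (ω j).1 = s j) ∧ ∀ j < l, (ω j).2 = t j} =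
      ENNReal.ofReal (cylinderScale r s k ^ p * cylinderScale r t l ^ p) := by
  have := isProbabilityMeasure_symbolMeasure hr hp
  rw [pairMeasure, infinitePi_prod_cylinder, prod_symbolMeasure hr, prod_symbolMeasure hr,
    ENNReal.ofReal_mul (Real.rpow_nonneg (cylinderScale_pos hr s k).le p)]

theorem isProbabilityMeasure_pairMeasure {m : ℕ} {r : Fin m → ℝ} {p : ℝ} (hr : ∀ i, 0 < r i)
    (hp : ∑ i, r i ^ p = 1) : IsProbabilityMeasure (pairMeasure r p) := by
  have := isProbabilityMeasure_symbolMeasure hr hp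
  unfold pairMeasure
  infer_instance

/-- The two sequences of symbols agree along arbitrarily long blocks arbitrarily far out, and
differ infinitely often. -/
def IsProximalNotAsymptotic {m : ℕ} (ω : ℕ → Fin m × Fin m) : Prop :=
  (∀ L, ∃ᶠ k in atTop, ∀ j < L, (ω (k + j)).1 = (ω (k + j)).2) ∧
    ∃ᶠ k in atTop, (ω k).1 ≠ (ω k).2

theorem ae_isProximalNotAsymptotic {m : ℕ} (hm : 2 ≤ m) {r : Fin m → ℝ} {p : ℝ}
    (hr : ∀ i, 0 < r i) (hp : ∑ i, r i ^ p = 1) :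
    ∀ᵐ ω ∂(pairMeasure r p), IsProximalNotAsymptotic ω := by
  have := isProbabilityMeasure_symbolMeasure hr hp
  have hpos : ∀ (A : Set (Fin m × Fin m)) (i j : Fin m), (i, j) ∈ A →
      ((symbolMeasure r p).prod (symbolMeasure r p)) A ≠ 0 := by
    intro A i j hij
    have h1 : ∀ i, symbolMeasure r p {i} ≠ 0 := fun i => by
      rw [symbolMeasure_singleton]
      simpa using Real.rpow_pos_of_pos (hr i) p
    have h2 : ((symbolMeasure r p).prod (symbolMeasure r p)) {(i, j)} ≠ 0 := by
      rw [← singleton_prod_singleton, Measure.prod_prod]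
      exact mul_ne_zero (h1 i) (h1 j)
    exact fun h0 => h2 (measure_mono_null (singleton_subset_iff.2 hij) h0)
  let i₀ : Fin m := ⟨0, by omega⟩
  let i₁ : Fin m := ⟨1, by omega⟩
  -- The length `L + 1` meets the positivity required of runs when `L = 0`.
  have hagree : ∀ L : ℕ, ∀ᵐ ω ∂(pairMeasure r p),
      ∃ᶠ k in atTop, ∀ j < L + 1, ω (k + j) ∈ {q : Fin m × Fin m | q.1 = q.2} := fun L =>
    ae_frequently_run_infinitePi _ (Set.toFinite _).measurableSet 
      (hpos {q | q.1 = q.2} i₀ i₀ rfl) L.succ_pos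
  have hdiff : ∀ᵐ ω ∂(pairMeasure r p),
      ∃ᶠ k in atTop, ∀ j < 1, ω (k + j) ∈ {q : Fin m × Fin m | q.1 ≠ q.2} :=
    ae_frequently_run_infinitePi _ (Set.toFinite _).measurableSet
      (hpos {q | q.1 ≠ q.2} i₀ i₁ (by simp [i₀, i₁])) one_pos
  filter_upwards [ae_all_iff.2 hagree, hdiff] with ω h1 h2
  exact ⟨fun L => (h1 L).mono fun k hk j hj => hk j (by omega),
    h2.mono fun k hk => hk 0 one_pos⟩

/-! ### Dimension of coded points and of pairs -/

namespace IsSelfSimilarCoding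

variable {X : Type*} [MetricSpace X] {m : ℕ} {r : Fin m → ℝ}
  {π : (ℕ → Fin m) → X} {δ C p : ℝ}

theorem dimH_range (h : IsSelfSimilarCoding r π δ C) (hp0 : 0 < p) (hp : ∑ i, r i ^ p = 1) :
    dimH (range π) = ENNReal.ofReal p := by
  borelize X
  have := isProbabilityMeasure_pairMeasure h.ratio_pos hp
  have hmeas : Measurable fun ω : ℕ → Fin m × Fin m => π fun k => (ω k).1 :=
    h.continuous.measurable.comp (by fun_prop)
  set ν := (pairMeasure r p).map fun ω => π fun k => (ω k).1 with hν
  have : IsProbabilityMeasure ν := Measure.isProbabilityMeasure_map hmeas.aemeasurable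
  have hδ := h.lower_pos
  have hC := h.upper_pos
  have hcyl : ∀ s k, pairMeasure r p {ω | ∀ j < k, (ω j).1 = s j} =
      ENNReal.ofReal (cylinderScale r s k ^ p) := fun s k => by
    -- Length `0` leaves the second sequence free, so this is the first marginal.
    simpa [cylinderScale_zero] using pairMeasure_cylinder h.ratio_pos hp s s k 0
  refine le_antisymm ?_ ?_
  · obtain ⟨σ, hσ0, hσ⟩ := exists_ratio_lower_bound h.ratio_pos
    refine dimH_le_of_le_measure_closedBall ν hp0.le (c := (σ / C) ^ p) (by positivity) hC ?_
    rintro _ ⟨s, rfl⟩ ε hε hεC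
    obtain ⟨k, hk, hsub⟩ := h.exists_cylinder_dist_le hσ s hε hεC
    rw [hν, Measure.map_apply hmeas Metric.isClosed_closedBall.measurableSet]
    refine le_trans ?_ (measure_mono 
      (s := {ω : ℕ → Fin m × Fin m | ∀ j < k, (ω j).1 = s j}) fun ω hω => hsub _ hω)
    rw [hcyl, ← Real.mul_rpow (by positivity) hε.le]
    refine ENNReal.ofReal_le_ofReal (Real.rpow_le_rpow (by positivity) (le_trans (le_of_eq ?_) hk)
      hp0.le)
    ring
  · refine le_dimH_of_measure_closedBall_le ν hp0 (c := (1 / δ) ^ p) (by positivity) ?_ ?_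
    · rintro _ ⟨s, rfl⟩ ε hε
      obtain ⟨k, hk, hsub⟩ := h.exists_cylinder_of_dist_le s hε
      rw [hν, Measure.map_apply hmeas Metric.isClosed_closedBall.measurableSet]
      refine (measure_mono 
        (t := {ω : ℕ → Fin m × Fin m | ∀ j < k, (ω j).1 = s j}) fun ω hω => hsub _ hω).trans ?_
      rw [hcyl, ← Real.mul_rpow (by positivity) hε.le]
      refine ENNReal.ofReal_le_ofReal (Real.rpow_le_rpow (cylinderScale_pos h.ratio_pos s k).le
        (hk.trans (le_of_eq ?_)) hp0.le)
      ring
    · refine (lt_of_lt_of_le ?_ (Measure.le_map_apply hmeas.aemeasurable _)).ne'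
      have : (fun ω : ℕ → Fin m × Fin m => π fun k => (ω k).1) ⁻¹' range π = univ :=
        eq_univ_of_forall fun ω => mem_range_self _
      rw [this, measure_univ]
      exact one_pos

/-- A set of pairs of coded points that contains all pairs with proximal, not asymptotic codes has
twice the dimension of the set of coded points. -/
theorem dimH_pairs [SecondCountableTopology X] (h : IsSelfSimilarCoding r π δ C) (hm : 2 ≤ m) (hp0 : 0 < p)
    (hp : ∑ i, r i ^ p = 1) {A : Set (X × X)} (hA : A ⊆ range π ×ˢ range π)
    (hA' : ∀ ω : ℕ → Fin m × Fin m, IsProximalNotAsymptotic ω →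
      (π fun k => (ω k).1, π fun k => (ω k).2) ∈ A) :
    dimH A = ENNReal.ofReal (2 * p) := by
  -- Second countability makes the product σ-algebra on `X × X` the Borel one.
  borelize X
  have := isProbabilityMeasure_pairMeasure h.ratio_pos hp
  have hmeas : Measurable fun ω : ℕ → Fin m × Fin m =>
      (π fun k => (ω k).1, π fun k => (ω k).2) :=
    (h.continuous.measurable.comp (by fun_prop)).prodMk
      (h.continuous.measurable.comp (by fun_prop))
  set ν := (pairMeasure r p).map fun ω => (π fun k => (ω k).1, π fun k => (ω k).2) with hν
  have : IsProbabilityMeasure ν := Measure.isProbabilityMeasure_map hmeas.aemeasurable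
  have hδ := h.lower_pos
  have hC := h.upper_pos
  have hsq : ∀ a : ℝ, 0 ≤ a → a ^ (2 * p) = a ^ p * a ^ p := fun a ha => by
    rw [two_mul, Real.rpow_add_of_nonneg ha hp0.le hp0.le]
  refine le_antisymm ?_ ?_
  · obtain ⟨σ, hσ0, hσ⟩ := exists_ratio_lower_bound h.ratio_pos
    refine dimH_le_of_le_measure_closedBall ν (by positivity) (c := (σ / C) ^ (2 * p))
      (by positivity) hC ?_
    intro z hz ε hε hεC
    obtain ⟨⟨s, hs⟩, ⟨t, ht⟩⟩ := hA hz
    obtain ⟨k, hk, hsubk⟩ := h.exists_cylinder_dist_le hσ s hε hεC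
    obtain ⟨l, hl, hsubl⟩ := h.exists_cylinder_dist_le hσ t hε hεC
    rw [hν, Measure.map_apply hmeas Metric.isClosed_closedBall.measurableSet]
    refine le_trans ?_ (measure_mono
      (s := {ω | (∀ j < k, (ω j).1 = s j) ∧ ∀ j < l, (ω j).2 = t j}) fun ω hω => ?_)
    · rw [pairMeasure_cylinder h.ratio_pos hp, ← Real.mul_rpow (by positivity) hε.le,
        hsq _ (by positivity)]
      have e : σ / C * ε = ε / C * σ := by ring
      rw [e]
      refine ENNReal.ofReal_le_ofReal (mul_le_mul ?_ ?_ (by positivity)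
        (Real.rpow_nonneg (cylinderScale_pos h.ratio_pos s k).le p))
      · exact Real.rpow_le_rpow (by positivity) hk hp0.le
      · exact Real.rpow_le_rpow (by positivity) hl hp0.le
    · rw [mem_preimage, Metric.mem_closedBall, Prod.dist_eq, ← hs, ← ht]
      exact max_le (hsubk _ hω.1) (hsubl _ hω.2)
  · refine le_dimH_of_measure_closedBall_le ν (by positivity) (c := (1 / δ) ^ (2 * p))
      (by positivity) ?_ ?_
    · intro z hz ε hε
      obtain ⟨⟨s, hs⟩, ⟨t, ht⟩⟩ := hA hz
      obtain ⟨k, hk, hsubk⟩ := h.exists_cylinder_of_dist_le s hε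
      obtain ⟨l, hl, hsubl⟩ := h.exists_cylinder_of_dist_le t hε
      rw [hν, Measure.map_apply hmeas Metric.isClosed_closedBall.measurableSet]
      refine (measure_mono
        (t := {ω | (∀ j < k, (ω j).1 = s j) ∧ ∀ j < l, (ω j).2 = t j}) fun ω hω => ?_).trans ?_
      · rw [mem_preimage, Metric.mem_closedBall, Prod.dist_eq, ← hs, ← ht] at hω
        exact ⟨hsubk _ ((le_max_left _ _).trans hω), hsubl _ ((le_max_right _ _).trans hω)⟩
      · rw [pairMeasure_cylinder h.ratio_pos hp, ← Real.mul_rpow (by positivity) hε.le,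
          hsq _ (by positivity)]
        have e : 1 / δ * ε = ε / δ := by ring
        rw [e]
        refine ENNReal.ofReal_le_ofReal (mul_le_mul ?_ ?_
          (Real.rpow_nonneg (cylinderScale_pos h.ratio_pos t l).le p) (by positivity))
        · exact Real.rpow_le_rpow (cylinderScale_pos h.ratio_pos s k).le hk hp0.le
        · exact Real.rpow_le_rpow (cylinderScale_pos h.ratio_pos t l).le hl hp0.le
    -- `A` need not be measurable: one inequality for the image measure suffices, and the preimage
    -- cannot be null because its complement is.
    · refine (lt_of_lt_of_le ?_ (Measure.le_map_apply hmeas.aemeasurable _)).ne'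
      have hae : ∀ᵐ ω ∂(pairMeasure r p),
          ω ∈ (fun ω : ℕ → Fin m × Fin m => (π fun k => (ω k).1, π fun k => (ω k).2)) ⁻¹' A :=
        (ae_isProximalNotAsymptotic hm h.ratio_pos hp).mono hA'
      refine pos_of_ne_zero fun h0 => ?_
      have hcompl := measure_union_null h0 (ae_iff.1 hae)
      have huniv := hcompl ▸ measure_mono (μ := pairMeasure r p) (s := univ) fun ω _ => em _
      exact absurd huniv (by simp)

end IsSelfSimilarCoding

/-! ### The Moran equation -/

/-- The Moran equation has exactly one real solution, and it is positive. -/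
theorem exists_moran_exponent {m : ℕ} (hm : 2 ≤ m) {r : Fin m → ℝ} (hr : ∀ i, 0 < r i)
    (hr1 : ∀ i, r i < 1) : ∃ p₀ : ℝ, 0 < p₀ ∧ ∀ p : ℝ, ∑ i, r i ^ p = 1 ↔ p = p₀ := by
  have hne : (Finset.univ : Finset (Fin m)).Nonempty := ⟨⟨0, by omega⟩, Finset.mem_univ _⟩
  have hanti : StrictAnti fun p : ℝ => ∑ i, r i ^ p := fun p q hpq =>
    Finset.sum_lt_sum_of_nonempty hne fun i _ =>
      Real.rpow_lt_rpow_of_exponent_gt (hr i) (hr1 i) hpq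
  have hcont : Continuous fun p : ℝ => ∑ i, r i ^ p :=
    continuous_finsetSum _ fun i _ => Real.continuous_const_rpow (hr i).ne'
  have hlim : Tendsto (fun p : ℝ => ∑ i, r i ^ p) atTop (𝓝 0) := by
    have := tendsto_finsetSum (Finset.univ : Finset (Fin m)) (f := fun i (p : ℝ) => r i ^ p)
      (a := fun _ => (0 : ℝ)) (x := atTop)
      fun i _ => tendsto_rpow_atTop_of_base_lt_one (r i) (by linarith [hr i]) (hr1 i)
    simpa using this
  obtain ⟨q, hq1, hq0⟩ := ((hlim.eventually_lt_const one_pos).and (eventually_gt_atTop 0)).exists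
  have h0 : (1 : ℝ) < ∑ i, r i ^ (0 : ℝ) := by
    have : (2 : ℝ) ≤ m := by exact_mod_cast hm
    simp
    linarith
  obtain ⟨p₀, hp₀, hp₀'⟩ := intermediate_value_Ioo' hq0.le hcont.continuousOn ⟨hq1, h0⟩
  exact ⟨p₀, hp₀.1, fun p => ⟨fun hp => hanti.injective (hp.trans hp₀'.symm), fun hp => hp ▸ hp₀'⟩⟩

/-! ### Basic sets and itineraries -/

theorem mem_basicSet {X : Type*} {m : ℕ} {f : X → X} {V : Fin m → Set X} {k : ℕ}
    {a : Fin (k + 1) → Fin m} {x : X} :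
    x ∈ basicSet f V k a ↔ ∀ j : Fin (k + 1), f^[(j : ℕ)] x ∈ V (a j) := by
  simp [basicSet]

theorem mem_limitSet_univ_basicSet {X : Type*} {m : ℕ} {f : X → X} {V : Fin m → Set X} {x : X} :
    x ∈ limitSet univ (basicSet f V) ↔ ∀ k, ∃ i, f^[k] x ∈ V i := by
  simp only [limitSet, mem_iInter, mem_iUnion, exists_prop, mem_basicSet]
  constructor
  · intro h k
    obtain ⟨a, -, ha⟩ := h k
    exact ⟨_, ha (Fin.last k)⟩
  · intro h k
    choose s hs using h
    exact ⟨fun j => s j, ⟨s, mem_univ _, fun _ => rfl⟩, fun j => hs j⟩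

theorem basicSet_succ {X : Type*} {m : ℕ} (f : X → X) (V : Fin m → Set X) (k : ℕ)
    (a : Fin (k + 2) → Fin m) :
    basicSet f V (k + 1) a = V (a 0) ∩ f ⁻¹' basicSet f V k (Fin.tail a) := by
  ext x
  simp only [mem_inter_iff, mem_preimage, mem_basicSet, Fin.tail]
  rw [Fin.forall_fin_succ]
  simp [Function.iterate_succ_apply]

theorem isClosed_basicSet {X : Type*} [TopologicalSpace X] {m : ℕ} {f : X → X}
    {V : Fin m → Set X} (hV : ∀ i, IsClosed (V i)) (hf : ContinuousOn f (⋃ i, V i)) (k : ℕ)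
    (a : Fin (k + 1) → Fin m) : IsClosed (basicSet f V k a) := by
  induction k with
  | zero =>
    have : basicSet f V 0 a = V (a 0) := by
      ext x
      simp [mem_basicSet]
    rw [this]
    exact hV _
  | succ k ih =>
    rw [basicSet_succ]
    exact (hf.mono (subset_iUnion V _)).preimage_isClosed_of_isClosed (hV _) (ih _)

theorem image_limitSet_univ_basicSet {X : Type*} {m : ℕ} {f : X → X} {V : Fin m → Set X}
    (hcov : ∀ i, (⋃ j, V j) ⊆ f '' V i) :
    f '' limitSet univ (basicSet f V) = limitSet univ (basicSet f V) := by
  ext y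
  constructor
  · rintro ⟨x, hx, rfl⟩
    rw [mem_limitSet_univ_basicSet] at hx ⊢
    exact fun k => hx (k + 1)
  · intro hy
    rw [mem_limitSet_univ_basicSet] at hy
    obtain ⟨i, hi⟩ := hy 0
    obtain ⟨x, hx, hxy⟩ := hcov i (mem_iUnion.2 ⟨i, hi⟩)
    refine ⟨x, mem_limitSet_univ_basicSet.2 fun k => ?_, hxy⟩
    cases k with
    | zero => exact ⟨i, hx⟩
    | succ k =>
      rw [Function.iterate_succ_apply, hxy]
      exact hy k

/-- Points are pulled back one letter at a time: a point realizing the tail lies in some `V j`,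
hence has a preimage in `V (a 0)`. -/
theorem nonempty_basicSet {X : Type*} {m : ℕ} {f : X → X} {V : Fin m → Set X}
    (hne : ∀ i, (V i).Nonempty) (hcov : ∀ i, (⋃ j, V j) ⊆ f '' V i) (k : ℕ)
    (a : Fin (k + 1) → Fin m) : (basicSet f V k a).Nonempty := by
  induction k with
  | zero =>
    obtain ⟨x, hx⟩ := hne (a 0)
    refine ⟨x, mem_basicSet.2 fun j => ?_⟩
    obtain rfl : j = 0 := Fin.fin_one_eq_zero j
    exact hx
  | succ k ih =>
    obtain ⟨y, hy⟩ := ih (Fin.tail a)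
    obtain ⟨x, hx, rfl⟩ := hcov (a 0) (mem_iUnion.2 ⟨_, mem_basicSet.1 hy 0⟩)
    rw [basicSet_succ]
    exact ⟨x, hx, hy⟩

/-- Every sequence of symbols is the itinerary of a point. -/
theorem exists_itinerary {X : Type*} [TopologicalSpace X] [T2Space X] {m : ℕ} {f : X → X}
    {V : Fin m → Set X} (hV : ∀ i, IsCompact (V i)) (hf : ContinuousOn f (⋃ i, V i))
    (hne : ∀ i, (V i).Nonempty) (hcov : ∀ i, (⋃ j, V j) ⊆ f '' V i) (s : ℕ → Fin m) :
    ∃ x, ∀ k, f^[k] x ∈ V (s k) := by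
  have hcl := isClosed_basicSet (fun i => (hV i).isClosed) hf
  obtain ⟨x, hx⟩ := IsCompact.nonempty_iInter_of_sequence_nonempty_isCompact_isClosed
    (fun k => basicSet f V k fun j => s j)
    (fun k x hx => mem_basicSet.2 fun j => mem_basicSet.1 hx j.castSucc)
    (fun k => nonempty_basicSet hne hcov k _)
    ((hV (s 0)).of_isClosed_subset (hcl _ _) fun x hx => mem_basicSet.1 hx 0)
    (fun k => hcl k _)
  exact ⟨x, fun k => mem_basicSet.1 (mem_iInter.1 hx k) (Fin.last k)⟩

/-! ### Metric consequences of expansion -/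

/-- Points with the same itinerary up to time `k` are brought together by the inverse branches. -/
theorem dist_eq_cylinderScale_mul {X : Type*} [MetricSpace X] {m : ℕ} {f : X → X}
    {V : Fin m → Set X} {lam : Fin m → ℝ} (hlam : ∀ i, 1 < lam i)
    (hexp : ∀ i, ∀ x ∈ V i, ∀ y ∈ V i, dist (f x) (f y) = lam i * dist x y)
    {s : ℕ → Fin m} {x y : X} {k : ℕ} (hx : ∀ j < k, f^[j] x ∈ V (s j))
    (hy : ∀ j < k, f^[j] y ∈ V (s j)) :
    dist x y = cylinderScale (fun i => 1 / lam i) s k * dist (f^[k] x) (f^[k] y) := by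
  induction k with
  | zero => simp [cylinderScale_zero]
  | succ k ih =>
    rw [ih (fun j hj => hx j (by omega)) (fun j hj => hy j (by omega)), cylinderScale_succ,
      Function.iterate_succ_apply', Function.iterate_succ_apply',
      hexp _ _ (hx k (Nat.lt_succ_self k)) _ (hy k (Nat.lt_succ_self k))]
    have : lam (s k) ≠ 0 := by linarith [hlam (s k)]
    field_simp

theorem exists_uniform_separation {X : Type*} [MetricSpace X] {m : ℕ} {V : Fin m → Set X}
    (hsep : ∀ i j, i ≠ j → Metric.AreSeparated (V i) (V j)) :
    ∃ δ : ℝ, 0 < δ ∧ ∀ i j, i ≠ j → ∀ x ∈ V i, ∀ y ∈ V j, δ ≤ dist x y := by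
  have hpair : ∀ q : Fin m × Fin m, ∃ d : ℝ, 0 < d ∧
      (q.1 ≠ q.2 → ∀ x ∈ V q.1, ∀ y ∈ V q.2, d ≤ dist x y) := by
    rintro ⟨i, j⟩
    by_cases hij : i = j
    · exact ⟨1, one_pos, fun h => absurd hij h⟩
    · obtain ⟨e, he0, he⟩ := hsep i j hij
      -- Truncation at `1` handles a separation constant equal to `⊤`.
      refine ⟨(min e 1).toReal, ENNReal.toReal_pos ?_ ?_, fun _ x hx y hy => ?_⟩
      · exact (lt_min (pos_of_ne_zero he0) one_pos).ne'
      · exact ne_top_of_le_ne_top ENNReal.one_ne_top (min_le_right _ _)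
      · rw [dist_edist]
        exact ENNReal.toReal_mono (edist_ne_top _ _) ((min_le_left _ _).trans (he x hx y hy))
  choose d hd0 hd using hpair
  rcases isEmpty_or_nonempty (Fin m × Fin m) with h | h
  · exact ⟨1, one_pos, fun i j => (h.false (i, j)).elim⟩
  · obtain ⟨q, hq⟩ := Finite.exists_min d
    exact ⟨d q, hd0 q, fun i j hij x hx y hy => (hq (i, j)).trans (hd (i, j) hij x hx y hy)⟩

theorem exists_uniform_dist_bound {X : Type*} [MetricSpace X] {m : ℕ} {V : Fin m → Set X}
    (hV : ∀ i, IsCompact (V i)) :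
    ∃ C : ℝ, 0 < C ∧ ∀ i j, ∀ x ∈ V i, ∀ y ∈ V j, dist x y ≤ C := by
  obtain ⟨C, hC⟩ := Metric.isBounded_iff.1 (isCompact_iUnion hV).isBounded
  exact ⟨max C 1, by positivity, fun i j x hx y hy =>
    (hC (mem_iUnion.2 ⟨i, hx⟩) (mem_iUnion.2 ⟨j, hy⟩)).trans (le_max_left _ _)⟩

theorem isSymbolicGeometricConstruction_basicSet {X : Type*} [MetricSpace X] {m : ℕ} {f : X → X}
    {V : Fin m → Set X} (hV : ∀ i, IsCompact (V i)) (hdisj : ∀ i j, i ≠ j → Disjoint (V i) (V j))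
    (hf : ContinuousOn f (⋃ i, V i)) {lam : Fin m → ℝ} (hlam : ∀ i, 1 < lam i)
    (hexp : ∀ i, ∀ x ∈ V i, ∀ y ∈ V i, dist (f x) (f y) = lam i * dist x y) :
    IsSymbolicGeometricConstruction (univ : Set (ℕ → Fin m)) (basicSet f V) where
  invariant := by
    rw [image_univ, range_eq_univ]
    intro s
    exact ⟨fun k => s (k - 1), funext fun k => by simp [shiftMap]⟩
  closed k a _ := isClosed_basicSet (fun i => (hV i).isClosed) hf k a
  nested k a _ x hx := mem_basicSet.2 fun j => mem_basicSet.1 hx j.castSucc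
  disjoint k a b _ _ hab := by
    obtain ⟨j, hj⟩ := Function.ne_iff.1 hab
    exact disjoint_left.2 fun x hx hx' =>
      disjoint_left.1 (hdisj _ _ hj) (mem_basicSet.1 hx j) (mem_basicSet.1 hx' j)
  diam_tendsto := by
    have hr : ∀ i, 0 < 1 / lam i := fun i => one_div_pos.2 (by linarith [hlam i])
    have hr1 : ∀ i, 1 / lam i < 1 := fun i => (div_lt_one (by linarith [hlam i])).2 (hlam i)
    obtain ⟨C, hC0, hC⟩ := exists_uniform_dist_bound hV
    obtain ⟨ρ, hρ0, hρ1, hρ⟩ := exists_ratio_bound hr1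
    have hlim : Tendsto (fun k : ℕ => ENNReal.ofReal (ρ ^ k * C)) atTop (𝓝 0) := by
      have := (tendsto_pow_atTop_nhds_zero_of_lt_one hρ0.le hρ1).mul_const C
      simpa using ENNReal.tendsto_ofReal this
    refine tendsto_of_tendsto_of_tendsto_of_le_of_le tendsto_const_nhds hlim
      (fun _ => zero_le) fun k => ?_
    refine iSup_le fun a => iSup_le fun ⟨s, _, hs⟩ => ?_
    refine Metric.ediam_le_of_forall_dist_le fun x hx y hy => ?_
    -- Only the first `k` letters contribute contraction; the last one merely bounds the distance of
    -- the `k`-th iterates by `C`.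
    have hit : ∀ z ∈ basicSet f V k a, ∀ j < k, f^[j] z ∈ V (s j) := fun z hz j hj => by
      have := mem_basicSet.1 hz ⟨j, by omega⟩
      rwa [← hs] at this
    rw [dist_eq_cylinderScale_mul hlam hexp (hit x hx) (hit y hy)]
    exact mul_le_mul (cylinderScale_le_pow hr hρ s k)
      (hC _ _ _ (mem_basicSet.1 hx (Fin.last k)) _ (mem_basicSet.1 hy (Fin.last k)))
      dist_nonneg (by positivity)

theorem isSelfSimilarCoding_of_itinerary {X : Type*} [MetricSpace X] {m : ℕ} {f : X → X}
    {V : Fin m → Set X} {lam : Fin m → ℝ} (hlam : ∀ i, 1 < lam i)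
    (hexp : ∀ i, ∀ x ∈ V i, ∀ y ∈ V i, dist (f x) (f y) = lam i * dist x y)
    {δ C : ℝ} (hδ0 : 0 < δ) (hδ : ∀ i j, i ≠ j → ∀ x ∈ V i, ∀ y ∈ V j, δ ≤ dist x y)
    (hC0 : 0 < C) (hC : ∀ i j, ∀ x ∈ V i, ∀ y ∈ V j, dist x y ≤ C)
    {π : (ℕ → Fin m) → X} (hπ : ∀ s k, f^[k] (π s) ∈ V (s k)) :
    IsSelfSimilarCoding (fun i => 1 / lam i) π δ C := by
  have hr : ∀ i, 0 < 1 / lam i := fun i => one_div_pos.2 (by linarith [hlam i])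
  have hdist : ∀ s t k, (∀ j < k, t j = s j) → dist (π t) (π s) =
      cylinderScale (fun i => 1 / lam i) s k * dist (f^[k] (π t)) (f^[k] (π s)) :=
    fun s t k h => dist_eq_cylinderScale_mul hlam hexp (fun j hj => h j hj ▸ hπ t j)
      fun j _ => hπ s j
  refine ⟨hr, fun i => (div_lt_one (by linarith [hlam i])).2 (hlam i), hδ0, hC0, ?_, ?_⟩
  · intro s t k h
    rw [hdist s t k h, mul_comm]
    exact mul_le_mul_of_nonneg_right (hC _ _ _ (hπ t k) _ (hπ s k)) (cylinderScale_pos hr s k).le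
  · intro s t k h hne
    rw [hdist s t k h, mul_comm]
    exact mul_le_mul_of_nonneg_left (hδ _ _ hne _ (hπ t k) _ (hπ s k))
      (cylinderScale_pos hr s k).le

/-- An itinerary determines its point. -/
theorem eq_of_same_itinerary {X : Type*} [MetricSpace X] {m : ℕ} {f : X → X}
    {V : Fin m → Set X} {lam : Fin m → ℝ} (hlam : ∀ i, 1 < lam i)
    (hexp : ∀ i, ∀ x ∈ V i, ∀ y ∈ V i, dist (f x) (f y) = lam i * dist x y)
    {C : ℝ} (hC : ∀ i j, ∀ x ∈ V i, ∀ y ∈ V j, dist x y ≤ C)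
    {s : ℕ → Fin m} {x y : X} (hx : ∀ k, f^[k] x ∈ V (s k)) (hy : ∀ k, f^[k] y ∈ V (s k)) :
    x = y := by
  have hr : ∀ i, 0 < 1 / lam i := fun i => one_div_pos.2 (by linarith [hlam i])
  have hr1 : ∀ i, 1 / lam i < 1 := fun i => (div_lt_one (by linarith [hlam i])).2 (hlam i)
  refine eq_of_forall_dist_le fun ε hε => ?_
  obtain ⟨k, hk, -⟩ := exists_first_scale_le hr hr1 s (c := C) hε
  rw [dist_eq_cylinderScale_mul hlam hexp (k := k) (fun j _ => hx j) fun j _ => hy j, mul_comm]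
  exact (mul_le_mul_of_nonneg_right (hC _ _ _ (hx k) _ (hy k))
    (cylinderScale_pos hr s k).le).trans hk

/-- Points whose itineraries are proximal and not asymptotic form a Li-Yorke pair. -/
theorem isLiYorkePair_of_itinerary {X : Type*} [MetricSpace X] {m : ℕ} {f : X → X}
    {V : Fin m → Set X} {lam : Fin m → ℝ} (hlam : ∀ i, 1 < lam i)
    (hexp : ∀ i, ∀ x ∈ V i, ∀ y ∈ V i, dist (f x) (f y) = lam i * dist x y)
    {δ C : ℝ} (hδ0 : 0 < δ) (hδ : ∀ i j, i ≠ j → ∀ x ∈ V i, ∀ y ∈ V j, δ ≤ dist x y)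
    (hC : ∀ i j, ∀ x ∈ V i, ∀ y ∈ V j, dist x y ≤ C)
    {ω : ℕ → Fin m × Fin m} (hω : IsProximalNotAsymptotic ω) {x y : X}
    (hx : ∀ k, f^[k] x ∈ V (ω k).1) (hy : ∀ k, f^[k] y ∈ V (ω k).2) : IsLiYorkePair f x y := by
  have hr : ∀ i, 0 < 1 / lam i := fun i => one_div_pos.2 (by linarith [hlam i])
  have hr1 : ∀ i, 1 / lam i < 1 := fun i => (div_lt_one (by linarith [hlam i])).2 (hlam i)
  obtain ⟨ρ, hρ0, hρ1, hρ⟩ := exists_ratio_bound hr1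
  constructor
  · have hlim : Tendsto (fun L : ℕ => ENNReal.ofReal (ρ ^ L * C)) atTop (𝓝 0) := by
      have := (tendsto_pow_atTop_nhds_zero_of_lt_one hρ0.le hρ1).mul_const C
      simpa using ENNReal.tendsto_ofReal this
    refine le_antisymm (ge_of_tendsto' hlim fun L => ?_) (zero_le)
    refine liminf_le_of_frequently_le ((hω.1 L).mono fun k hk => ?_)
    rw [edist_dist]
    refine ENNReal.ofReal_le_ofReal ?_
    have hx' : ∀ j, f^[j] (f^[k] x) ∈ V (ω (k + j)).1 := fun j => by
      rw [← Function.iterate_add_apply, add_comm]; exact hx _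
    have hy' : ∀ j, f^[j] (f^[k] y) ∈ V (ω (k + j)).2 := fun j => by
      rw [← Function.iterate_add_apply, add_comm]; exact hy _
    rw [dist_eq_cylinderScale_mul hlam hexp (k := L) (s := fun j => (ω (k + j)).1)
      (fun j _ => hx' j) (fun j hj => hk j hj ▸ hy' j)]
    exact mul_le_mul (cylinderScale_le_pow hr hρ _ L) (hC _ _ _ (hx' L) _ (hy' L)) dist_nonneg
      (by positivity)
  · refine lt_of_lt_of_le (ENNReal.ofReal_pos.2 hδ0)
      (le_limsup_of_frequently_le (hω.2.mono fun k hk => ?_))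
    rw [edist_dist]
    exact ENNReal.ofReal_le_ofReal (hδ _ _ hk _ (hx k) _ (hy k))

/-! ### The main theorem -/

theorem theorem3p2 {n m : ℕ} (D : Set (EuclideanSpace ℝ (Fin n)))
    (hDclosed : IsClosed D) (hDbdd : Bornology.IsBounded D)
    (f : EuclideanSpace ℝ (Fin n) → EuclideanSpace ℝ (Fin n))
    (V : Fin m → Set (EuclideanSpace ℝ (Fin n)))
    (hVcompact : ∀ i, IsCompact (V i))
    (hVdisj : ∀ i j, i ≠ j → Disjoint (V i) (V j))
    (hf : IsStrictlyCoupledExpanding f D V)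
    (hfcont : ContinuousOn f (⋃ i, V i))
    (lam : Fin m → ℝ) (hlam : ∀ i, 1 < lam i)
    (hexp : ∀ i, ∀ x ∈ V i, ∀ y ∈ V i, dist (f x) (f y) = lam i * dist x y) :
    IsSymbolicGeometricConstruction (Set.univ : Set (ℕ → Fin m)) (basicSet f V) ∧
    f '' limitSet Set.univ (basicSet f V) = limitSet Set.univ (basicSet f V) ∧
    ∃ p₀ : ℝ, 0 < p₀ ∧ (∀ p : ℝ, ∑ i, (1 / lam i) ^ p = 1 ↔ p = p₀) ∧
      dimH (limitSet Set.univ (basicSet f V)) = ENNReal.ofReal p₀ ∧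
      dimH (liYorkePairs f (limitSet Set.univ (basicSet f V))) = ENNReal.ofReal (2 * p₀) := by
  have hcov := hf.covers
  obtain ⟨δ, hδ0, hδ⟩ := exists_uniform_separation hf.separated
  obtain ⟨C, hC0, hC⟩ := exists_uniform_dist_bound hVcompact
  choose π hπ using exists_itinerary hVcompact hfcont hf.nonempty hcov
  have hcoding := isSelfSimilarCoding_of_itinerary hlam hexp hδ0 hδ hC0 hC hπ
  have hrange : limitSet univ (basicSet f V) = range π := by
    ext x
    rw [mem_limitSet_univ_basicSet]
    constructor
    · intro h
      choose s hs using h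
      exact ⟨s, eq_of_same_itinerary hlam hexp hC (hπ s) hs⟩
    · rintro ⟨s, rfl⟩ k
      exact ⟨s k, hπ s k⟩
  obtain ⟨p₀, hp₀, huniq⟩ :=
    exists_moran_exponent hf.two_le hcoding.ratio_pos hcoding.ratio_lt_one
  have hsum := (huniq p₀).2 rfl
  refine ⟨isSymbolicGeometricConstruction_basicSet hVcompact hVdisj hfcont hlam hexp,
    image_limitSet_univ_basicSet hcov, p₀, hp₀, huniq, ?_, ?_⟩
  · rw [hrange]
    exact hcoding.dimH_range hp₀ hsum
  · rw [hrange]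
    refine hcoding.dimH_pairs hf.two_le hp₀ hsum (fun z hz => ⟨hz.1, hz.2.1⟩) fun ω hω => ?_
    exact ⟨mem_range_self _, mem_range_self _,
      isLiYorkePair_of_itinerary hlam hexp hδ0 hδ hC hω (hπ fun k => (ω k).1)
        (hπ fun k => (ω k).2)⟩
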